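/- Let $\Omega\subset\mathbb{R}^N$ be a bounded domain, $\sigma\in(0,1)$, and let $\{\nu_x\}_{x\in\mathbb{R}^N}$ be a family of (nonnegative Borel) measures on $\mathbb{R}^N$ satisfying, for some constants $C_{R,\alpha}$: (M1) for all $R>0$, $\alpha\in[0,2]$ and $\delta>0$, $\ \sup_{|x|\le R}\int_{B_\delta^c}\min\{1,|z|^\alpha\}\,\nu_x(dz)\le C_{R,\alpha}\,h_{\alpha,\sigma}(\delta)$, where $h_{\alpha,\sigma}(\delta)=\delta^{\alpha-\sigma}$ if $\alpha<\sigma$, $h_{\alpha,\sigma}(\delta)=|\ln\delta|+1$ if $\alpha=\sigma$, $h_{\alpha,\sigma}(\delta)=1$ if $\alpha>\sigma$ (and $|z|^0=1$ for all $z$); (M2) for all $R>0$, $\alpha\in(\sigma,2]$ and $\delta\in(0,1)$, $\ \sup_{|x|\le R}\int_{B_\delta}|z|^\alpha\,\nu_x(dz)\le C_{R,\alpha}\,\delta^{\alpha-\sigma}$. Here $B_\delta$ is the open ball of radius $\delta$ centred at $0$. Put $I_x(\phi,y)=\int_{\mathbb{R}^N}[\phi(y+z)-\phi(y)]\,\nu_x(dz)$.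 Let $m\in(\sigma,1]$, $\theta\in[0,m)$, $b_0,A>0$, let $d_\Omega$ denote the distance to $\partial\Omega$, and consider the equation $$-I_x(u,x)+b_0|Du(x)|^m=A\,(d_\Omega(x)^{-\theta}+1),\qquad x\in\Omega.\tag{P'}$$ A bounded viscosity subsolution of (P') is a bounded Borel function $u:\mathbb{R}^N\to\mathbb{R}$, upper semicontinuous on $\Omega$, such that whenever $x\in\Omega$, $\delta>0$, $\phi\in C^2(\mathbb{R}^N)$ and $u-\phi$ has a maximum over the open ball $B_\delta(x)$ at $x$, one has $$-\int_{B_\delta}[\phi(x+z)-\phi(x)]\,\nu_x(dz)-\int_{B_\delta^c}[u(x+z)-u(x)]\,\nu_x(dz)+b_0|D\phi(x)|^m\le A\,(d_\Omega(x)^{-\theta}+1).$$ Let $\Omega^\delta=\{x\in\Omega: d_\Omega(x)>\delta\}$, $\Omega_\nu=\Omega\cup\bigcup_{x\in\bar\Omega}(x+\mathrm{supp}\,\nu_x)$, $\mathrm{osc}_S(u)=\sup_S u-\inf_S u$, and $$\gamma_0=\min\{1,(m-\theta)/m\}.$$ Then, for each $\gamma\in(0,\gamma_0)$, every bounded viscosity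 subsolution $u$ of (P') is locally H\"older continuous in $\Omega$ with exponent $\gamma$, that is, $\gamma$-H\"older continuous on each compact subset of $\Omega$. Moreover, there is a nondecreasing function $K:\mathbb{R}\to\mathbb{R}$, depending only on the data $N,\Omega,\sigma,m,\theta,b_0,A,\gamma$ and on the constants in (M1) and (M2), such that for every such family $\{\nu_x\}$, every bounded viscosity subsolution $u$ of (P') and every $\delta>0$, $$|u(x)-u(y)|\le K\big(\mathrm{osc}_{\Omega_\nu}(u)\,\delta^{-\gamma}\big)\,|x-y|^\gamma\qquad\text{for all }x,y\in\Omega^\delta.$$ -/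

import Mathlib

namespace NonlocalHJ

noncomputable section

/-- Euclidean space of dimension `N`. -/
abbrev E (N : ℕ) : Type := EuclideanSpace ℝ (Fin N)

/-- The profile `h_{α,σ}(δ)`: `δ^(α-σ)` if `α < σ`, `|log δ| + 1` if `α = σ`, and `1` if `α > σ`. -/
def hProfile (α σ δ : ℝ) : ℝ :=
  if α < σ then δ ^ (α - σ) else if α = σ then |Real.log δ| + 1 else 1

/-- Condition (M1) of order `σ` for a family `ν` of measures, with constants `C R α`
(note that `‖z‖ ^ 0 = 1` for every `z`). -/
def CondM1 {N : ℕ} (σ : ℝ) (C : ℝ → ℝ → ℝ) (ν : E N → MeasureTheory.Measure (E N)) : Prop :=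
  ∀ R : ℝ, 0 < R → ∀ α ∈ Set.Icc (0 : ℝ) 2, ∀ δ : ℝ, 0 < δ →
    ∀ x ∈ Metric.closedBall (0 : E N) R,
      ∫⁻ z in (Metric.ball (0 : E N) δ)ᶜ, ENNReal.ofReal (min 1 (‖z‖ ^ α)) ∂(ν x)
        ≤ ENNReal.ofReal (C R α * hProfile α σ δ)

/-- Condition (M2) of order `σ` for a family `ν` of measures, with constants `C R α`. -/
def CondM2 {N : ℕ} (σ : ℝ) (C : ℝ → ℝ → ℝ) (ν : E N → MeasureTheory.Measure (E N)) : Prop :=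
  ∀ R : ℝ, 0 < R → ∀ α ∈ Set.Ioc σ 2, ∀ δ ∈ Set.Ioo (0 : ℝ) 1,
    ∀ x ∈ Metric.closedBall (0 : E N) R,
      ∫⁻ z in Metric.ball (0 : E N) δ, ENNReal.ofReal (‖z‖ ^ α) ∂(ν x)
        ≤ ENNReal.ofReal (C R α * δ ^ (α - σ))

/-- The part over `S` of the nonlocal operator of order `σ < 1`:
`∫_S (φ (x + z) - φ x) μ(dz)`. -/
def nonlocalPart {N : ℕ} (μ : MeasureTheory.Measure (E N)) (S : Set (E N)) (φ : E N → ℝ)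
    (x : E N) : ℝ :=
  ∫ z in S, (φ (x + z) - φ x) ∂μ

/-- The distance to the boundary of `Ω`, used only at points of `Ω`. -/
def bdryDist {N : ℕ} (Ω : Set (E N)) (x : E N) : ℝ :=
  Metric.infDist x (frontier Ω)

/-- The set `Ω^δ` of points of `Ω` at distance larger than `δ` from the boundary. -/
def innerSet {N : ℕ} (Ω : Set (E N)) (δ : ℝ) : Set (E N) :=
  {x | x ∈ Ω ∧ δ < bdryDist Ω x}

/-- The reachable set `Ω_ν = Ω ∪ ⋃_{x ∈ closure Ω} (x + supp ν_x)`. -/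
def reachSet {N : ℕ} (Ω : Set (E N)) (ν : E N → MeasureTheory.Measure (E N)) : Set (E N) :=
  Ω ∪ ⋃ x ∈ closure Ω, (fun z => x + z) '' (ν x).support

/-- The oscillation `sup_S u - inf_S u`. -/
def osc {N : ℕ} (S : Set (E N)) (u : E N → ℝ) : ℝ :=
  sSup (u '' S) - sInf (u '' S)

/-- Bounded viscosity subsolutions `u : ℝ^N → ℝ` of
`-I_x(u,x) + b₀ |Du|^m = A (d_Ω^(-θ) + 1)` in `Ω`, where `I_x` is the operator of order `σ < 1`
given by `ν`: whenever a `C²` function `φ` is such that `u - φ` has a maximum over the ball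
`B_δ(x)` at `x ∈ Ω`, the inequality holds with `Dφ(x)` as gradient and with
`I_x[B_δ](φ, x) + I_x[B_δᶜ](u, x)` as nonlocal term. -/
structure IsBddViscSubsol {N : ℕ} (Ω : Set (E N)) (ν : E N → MeasureTheory.Measure (E N))
    (m θ b₀ A : ℝ) (u : E N → ℝ) : Prop where
  measurable : Measurable u
  bounded : ∃ M : ℝ, ∀ x, |u x| ≤ M
  usc : UpperSemicontinuousOn u Ω
  subsol : ∀ x ∈ Ω, ∀ δ : ℝ, 0 < δ → ∀ φ : E N → ℝ, ContDiff ℝ 2 φ →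
    (∀ y ∈ Metric.ball x δ, u y - φ y ≤ u x - φ x) →
      -(nonlocalPart (ν x) (Metric.ball 0 δ) φ x + nonlocalPart (ν x) (Metric.ball 0 δ)ᶜ u x)
          + b₀ * ‖gradient φ x‖ ^ m
        ≤ A * (bdryDist Ω x ^ (-θ) + 1)

end

end NonlocalHJ

/-! For `x` in `Ω^δ`, compare `u` with the cone `u x + L |· - x|^γ`. If the cone fails to dominate
`u`, then `u - L |· - x|^γ` has a maximum at some `y ≠ x`; put `ρ = |y - x|`. The gradient term
there is `b₀ (γ L)^m ρ^((γ-1)m)`.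

With `α = m + γ(1-m)`, that is `γ - α = (γ-1)m`, maximality and the moments of order `α > σ` bound
the nonlocal term by a multiple of `L ρ^(γ-α) r^(α-σ)`: the same power of `ρ`. So only constants
compete. Coercivity wins, although `m ≤ 1`, because the radius `r = κ δ` is small and `m > σ`; the
source is absorbed because `θ ≤ (1-γ)m`. The core is `gradient_estimate`, `sub_le_mul_rpow` and
`exists_holder_constants`. -/

open MeasureTheory

namespace NonlocalHJ

/-! ### Elementary inequalities and geometry of `Ω` -/

/-- The Bochner integral of any function is at most the Lebesgue integral of its positive part. -/
theorem integral_le_of_lintegral_ofReal_le {α : Type*} [MeasurableSpace α] {μ : Measure α}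
    {f : α → ℝ} {c : ℝ} (hc : 0 ≤ c) (h : ∫⁻ a, ENNReal.ofReal (f a) ∂μ ≤ ENNReal.ofReal c) :
    ∫ a, f a ∂μ ≤ c := by
  by_cases hf : Integrable f μ
  · rw [integral_eq_lintegral_pos_part_sub_lintegral_neg_part hf]
    have := ENNReal.toReal_mono ENNReal.ofReal_ne_top h
    rw [ENNReal.toReal_ofReal hc] at this
    have := ENNReal.toReal_nonneg (a := ∫⁻ a, ENNReal.ofReal (-f a) ∂μ)
    linarith
  -- A non-integrable function has integral `0`, so `0 ≤ c` suffices.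
  · rwa [integral_undef hf]

/-- The power `t ^ γ` lies below its tangent as a function of `t ^ 2`. -/
theorem rpow_le_add_mul_sq_sub_sq {γ ρ t : ℝ} (hγ : 0 ≤ γ) (hγ2 : γ ≤ 2) (hρ : 0 < ρ)
    (ht : 0 ≤ t) : t ^ γ ≤ ρ ^ γ + γ / 2 * ρ ^ (γ - 2) * (t ^ 2 - ρ ^ 2) := by
  -- Bernoulli's inequality for the concave power `s ^ (γ / 2)` at `s = (t / ρ) ^ 2`.
  have h := rpow_one_add_le_one_add_mul_self (s := (t / ρ) ^ 2 - 1)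
    (by nlinarith [sq_nonneg (t / ρ)]) (p := γ / 2) (by linarith) (by linarith)
  have hq : 0 ≤ t / ρ := by positivity
  rw [add_sub_cancel, ← Real.rpow_natCast, ← Real.rpow_mul hq] at h
  have e : ((2 : ℕ) : ℝ) * (γ / 2) = γ := by push_cast; ring
  rw [e, Real.div_rpow ht hρ.le, div_le_iff₀ (by positivity)] at h
  refine h.trans_eq ?_
  rw [Real.rpow_sub hρ, Real.rpow_natCast, Real.rpow_two]
  field_simp

/-- Closed balls centred in `Ω` with radius smaller than the distance to the boundary
stay inside `Ω`. -/
theorem closedBall_subset_of_lt_bdryDist {N : ℕ} {Ω : Set (E N)} {x : E N} {r : ℝ} (hx : x ∈ Ω)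
    (hr : 0 ≤ r) (h : r < bdryDist Ω x) : Metric.closedBall x r ⊆ Ω := by
  have hd : Disjoint (frontier Ω) (Metric.closedBall x r) := by
    rw [Set.disjoint_left]
    intro y hy hyr
    have h1 := Metric.infDist_le_dist_of_mem (x := x) hy
    rw [Metric.mem_closedBall, dist_comm] at hyr
    unfold bdryDist at h
    linarith
  have hp : IsPreconnected (Metric.closedBall x r) := (convex_closedBall x r).isPreconnected
  by_contra hc
  obtain ⟨y, hy, hyΩ⟩ := Set.not_subset.1 hc
  have hsub : Metric.closedBall x r ⊆ interior Ω ∪ (closure Ω)ᶜ := by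
    intro z hz
    have : z ∉ frontier Ω := fun hf => Set.disjoint_left.1 hd hf hz
    by_cases h1 : z ∈ closure Ω
    · by_contra h2
      exact this ⟨h1, fun h3 => h2 (Or.inl h3)⟩
    · exact Or.inr h1
  obtain ⟨z, -, hz1, hz2⟩ := hp _ _ isOpen_interior isClosed_closure.isOpen_compl hsub
    ⟨x, Metric.mem_closedBall_self hr, by
      rcases hsub (Metric.mem_closedBall_self hr) with h1 | h1
      · exact h1
      · exact absurd (subset_closure hx) h1⟩
    ⟨y, hy, by
      rcases hsub hy with h1 | h1
      · exact absurd (interior_subset h1) hyΩ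
      · exact h1⟩
  exact hz2 (subset_closure (interior_subset hz1))

/-- Interpolation of powers: `t ^ γ ≤ ρ ^ (γ - α) * t ^ α` for `ρ ≤ t`, `γ ≤ α`. -/
theorem rpow_le_rpow_sub_mul_rpow {γ α ρ t : ℝ} (hρ : 0 < ρ) (hγα : γ ≤ α) (ht : ρ ≤ t) :
    t ^ γ ≤ ρ ^ (γ - α) * t ^ α := by
  have ht0 : 0 < t := hρ.trans_le ht
  calc t ^ γ = t ^ (γ - α) * t ^ α := by rw [← Real.rpow_add ht0]; ring_nf
    _ ≤ _ := by
      exact mul_le_mul_of_nonneg_right (Real.rpow_le_rpow_of_nonpos hρ ht (by linarith))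
        (by positivity)

/-- Interpolation of powers: `ρ ^ (γ - 1) * t ≤ ρ ^ (γ - α) * t ^ α` for `t ≤ ρ`, `α ≤ 1`. -/
theorem rpow_sub_one_mul_le {γ α ρ t : ℝ} (hρ : 0 < ρ) (hα : 0 < α) (hα1 : α ≤ 1) (ht : 0 ≤ t)
    (htρ : t ≤ ρ) : ρ ^ (γ - 1) * t ≤ ρ ^ (γ - α) * t ^ α := by
  rcases ht.eq_or_lt with rfl | ht0
  · simp [Real.zero_rpow hα.ne']
  have h1 : t ^ (1 - α) ≤ ρ ^ (1 - α) := Real.rpow_le_rpow ht htρ (by linarith)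
  calc ρ ^ (γ - 1) * t = ρ ^ (γ - 1) * (t ^ α * t ^ (1 - α)) := by
        rw [← Real.rpow_add ht0]; simp
    _ ≤ ρ ^ (γ - 1) * (t ^ α * ρ ^ (1 - α)) := by gcongr
    _ = (ρ ^ (γ - 1) * ρ ^ (1 - α)) * t ^ α := by ring
    _ = _ := by rw [← Real.rpow_add hρ]; ring_nf

/-- The gradient of a quadratic test function centred at `x`. -/
theorem gradient_const_mul_normSq_sub {N : ℕ} (c : ℝ) (x y : E N) :
    gradient (fun w : E N => c * ‖w - x‖ ^ 2) y = (2 * c) • (y - x) := by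
  apply HasGradientAt.gradient
  rw [hasGradientAt_iff_hasFDerivAt]
  have h := (((hasFDerivAt_id y).sub_const x).norm_sq).const_mul c
  refine h.congr_fderiv ?_
  ext v
  simp
  ring

/-- The difference of two values of a bounded function on a set is at most its oscillation. -/
theorem sub_le_osc {N : ℕ} {S : Set (E N)} {u : E N → ℝ} {M : ℝ} (hM : ∀ x, |u x| ≤ M)
    {x y : E N} (hx : x ∈ S) (hy : y ∈ S) : u x - u y ≤ osc S u := by
  have h1 : u x ≤ sSup (u '' S) := le_csSup
    ⟨M, by rintro _ ⟨z, -, rfl⟩; exact (abs_le.1 (hM z)).2⟩ ⟨x, hx, rfl⟩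
  have h2 : sInf (u '' S) ≤ u y := csInf_le
    ⟨-M, by rintro _ ⟨z, -, rfl⟩; exact (abs_le.1 (hM z)).1⟩ ⟨y, hy, rfl⟩
  unfold osc
  linarith

/-! ### Viscosity inequality at a contact point -/

/-- The moment bound of (M2) with exponent `α`, multiplied by a nonnegative constant. -/
theorem lintegral_ball_mul_rpow_le {N : ℕ} {σ : ℝ} {C : ℝ → ℝ → ℝ} {ν : E N → Measure (E N)}
    (h : CondM2 σ C ν) {R α r k : ℝ} (hR : 0 < R) (hα : α ∈ Set.Ioc σ 2)
    (hr : r ∈ Set.Ioo (0 : ℝ) 1) {y : E N} (hy : ‖y‖ ≤ R) (hk : 0 ≤ k) :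
    ∫⁻ z in Metric.ball (0 : E N) r, ENNReal.ofReal (k * ‖z‖ ^ α) ∂(ν y)
      ≤ ENNReal.ofReal (k * (max (C R α) 0 * r ^ (α - σ))) := by
  simp_rw [ENNReal.ofReal_mul hk]
  rw [lintegral_const_mul' _ _ ENNReal.ofReal_ne_top]
  gcongr
  refine (h R hR α hα r hr y (by simpa using hy)).trans ?_
  gcongr
  · exact Real.rpow_nonneg hr.1.le _
  · exact le_max_left _ _

/-- The tail bound of (M1) with exponent `0`, multiplied by a nonnegative constant. -/
theorem lintegral_compl_ball_const_le {N : ℕ} {σ : ℝ} {C : ℝ → ℝ → ℝ} {ν : E N → Measure (E N)}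
    (h : CondM1 σ C ν) (hσ : 0 < σ) {R r k : ℝ} (hR : 0 < R) (hr : 0 < r) {y : E N}
    (hy : ‖y‖ ≤ R) (hk : 0 ≤ k) :
    ∫⁻ _ in (Metric.ball (0 : E N) r)ᶜ, ENNReal.ofReal k ∂(ν y)
      ≤ ENNReal.ofReal (k * (max (C R 0) 0 * r ^ (-σ))) := by
  have h0 := h R hR 0 ⟨le_rfl, by norm_num⟩ r hr y (by simpa using hy)
  simp only [Real.rpow_zero, min_self, ENNReal.ofReal_one, hProfile, if_pos hσ, zero_sub] at h0
  rw [← mul_one (ENNReal.ofReal k), lintegral_const_mul' _ _ ENNReal.ofReal_ne_top,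
    ENNReal.ofReal_mul hk]
  gcongr
  refine h0.trans ?_
  gcongr
  exact le_max_left _ _

/-- The subsolution inequality at a maximum point `y` of `u - L |· - x| ^ γ`: the nonlocal term is
estimated by the moments of order `α` near `0` and by the oscillation of `u` far away. -/
theorem IsBddViscSubsol.gradient_estimate {N : ℕ} {Ω : Set (E N)} {ν : E N → Measure (E N)}
    {m θ b₀ A : ℝ} {u : E N → ℝ} (hu : IsBddViscSubsol Ω ν m θ b₀ A u)
    {σ : ℝ} {C₁ C₂ : ℝ → ℝ → ℝ} (h₁ : CondM1 σ C₁ ν) (h₂ : CondM2 σ C₂ ν) (hσ : 0 < σ)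
    {R α γ r L ω : ℝ} (hR : 0 < R) (hα : σ < α) (hα1 : α ≤ 1) (hγ : 0 < γ) (hγα : γ ≤ α)
    (hr1 : r < 1) (hL : 0 ≤ L) (hω : 0 ≤ ω)
    {x y : E N} (hy : y ∈ Ω) (hyR : ‖y‖ ≤ R) (hxy : x ≠ y) (hyr : dist y x < r)
    (hosc : ∀ z ∈ (ν y).support, u (y + z) - u y ≤ ω)
    (hmax : ∀ w, w ∈ Metric.ball y (dist y x) ∨ w ∈ (fun z => y + z) '' (ν y).support →
      u w - L * dist w x ^ γ ≤ u y - L * dist y x ^ γ) :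
    b₀ * (γ * L * dist y x ^ (γ - 1)) ^ m
      ≤ A * (bdryDist Ω y ^ (-θ) + 1)
        + (5 / 2 * L * dist y x ^ (γ - α) * (max (C₂ R α) 0 * r ^ (α - σ))
          + ω * (max (C₁ R 0) 0 * r ^ (-σ))) := by
  set ρ := dist y x with hρdef
  have hρ : 0 < ρ := dist_pos.2 hxy.symm
  have hr : 0 < r := hρ.trans hyr
  have hρn : ‖y - x‖ = ρ := (dist_eq_norm y x).symm
  set c := L * (γ / 2 * ρ ^ (γ - 2)) with hc
  have hc0 : 0 ≤ c := by positivity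
  have hρ2 : ρ ^ (γ - 2) * ρ = ρ ^ (γ - 1) := by
    rw [← Real.rpow_add_one hρ.ne']; ring_nf
  -- The power `|· - x|^γ` is not `C²` at `x`. The paraboloid touching it from above on the sphere
  -- of radius `ρ` is smooth and has the same gradient at `y`.
  have hs := hu.subsol y hy ρ hρ (fun w => c * ‖w - x‖ ^ 2)
    (contDiff_const.mul ((contDiff_id.sub contDiff_const).norm_sq ℝ)) (by
      intro w hw
      have h1 := hmax w (Or.inl hw)
      have h2 := mul_le_mul_of_nonneg_left (rpow_le_add_mul_sq_sub_sq (γ := γ) hγ.le (by linarith)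
        hρ (dist_nonneg (x := w) (y := x))) hL
      rw [dist_eq_norm w x] at h1 h2
      have h3 : L * (ρ ^ γ + γ / 2 * ρ ^ (γ - 2) * (‖w - x‖ ^ 2 - ρ ^ 2))
        = L * ρ ^ γ + c * ‖w - x‖ ^ 2 - c * ρ ^ 2 := by rw [hc]; ring
      simp only [hρn]
      linarith)
  rw [gradient_const_mul_normSq_sub, norm_smul, hρn] at hs
  have hgrad : ‖2 * c‖ * ρ = γ * L * ρ ^ (γ - 1) := by
    rw [Real.norm_of_nonneg (by positivity), hc, ← hρ2]; ring
  rw [hgrad] at hs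
  have hα2 : α ∈ Set.Ioc σ 2 := ⟨hα, by linarith⟩
  have hk : 0 ≤ L * ρ ^ (γ - α) := by positivity
  have hnear : nonlocalPart (ν y) (Metric.ball 0 ρ) (fun w => c * ‖w - x‖ ^ 2) y
      ≤ 3 / 2 * (L * ρ ^ (γ - α)) * (max (C₂ R α) 0 * r ^ (α - σ)) := by
    refine integral_le_of_lintegral_ofReal_le (by positivity) ?_
    refine le_trans ?_ (lintegral_ball_mul_rpow_le h₂ hR hα2 ⟨hr, hr1⟩ hyR
      (k := 3 / 2 * (L * ρ ^ (γ - α))) (by positivity))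
    refine le_trans ?_ (lintegral_mono_set (Metric.ball_subset_ball hyr.le))
    refine setLIntegral_mono' Metric.isOpen_ball.measurableSet fun z hz => ?_
    gcongr
    rw [mem_ball_zero_iff] at hz
    have e1 : ‖y + z - x‖ ≤ ρ + ‖z‖ := by
      rw [← hρn, show y + z - x = (y - x) + z by abel]; exact norm_add_le _ _
    have e2 := rpow_sub_one_mul_le (γ := γ) hρ (hσ.trans hα) hα1 (norm_nonneg z) hz.le
    calc c * ‖y + z - x‖ ^ 2 - c * ‖y - x‖ ^ 2
        ≤ c * (ρ + ‖z‖) ^ 2 - c * ρ ^ 2 := by rw [hρn]; gcongr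
      _ = c * (2 * ρ + ‖z‖) * ‖z‖ := by ring
      _ ≤ c * (2 * ρ + ρ) * ‖z‖ := by gcongr
      _ = 3 / 2 * L * γ * ((ρ ^ (γ - 2) * ρ) * ‖z‖) := by rw [hc]; ring
      _ ≤ 3 / 2 * L * 1 * (ρ ^ (γ - α) * ‖z‖ ^ α) := by
        rw [hρ2]; gcongr; linarith
      _ = _ := by ring
  have hfar : nonlocalPart (ν y) (Metric.ball 0 ρ)ᶜ u y
      ≤ L * ρ ^ (γ - α) * (max (C₂ R α) 0 * r ^ (α - σ)) + ω * (max (C₁ R 0) 0 * r ^ (-σ)) := by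
    refine integral_le_of_lintegral_ofReal_le (by positivity) ?_
    rw [ENNReal.ofReal_add (by positivity) (by positivity)]
    -- On `ρ ≤ |z| < r` maximality and subadditivity of `t ^ γ` give the increment bound `L |z|^γ`;
    -- beyond `r` only the oscillation is used.
    refine le_trans (lintegral_mono_set (t := (Metric.ball 0 r \ Metric.ball 0 ρ) ∪
      (Metric.ball 0 r)ᶜ) fun z hz => ?_) ((lintegral_union_le _ _ _).trans (add_le_add ?_ ?_))
    · by_cases hzr : z ∈ Metric.ball (0 : E N) r
      · exact Or.inl ⟨hzr, hz⟩
      · exact Or.inr hzr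
    · refine le_trans ?_ (lintegral_ball_mul_rpow_le h₂ hR hα2 ⟨hr, hr1⟩ hyR hk)
      refine le_trans ?_ (lintegral_mono_set (Set.sdiff_subset (t := Metric.ball 0 ρ)))
      refine setLIntegral_mono_ae' (Metric.isOpen_ball.measurableSet.diff
        Metric.isOpen_ball.measurableSet) ?_
      filter_upwards [Measure.support_mem_ae (μ := ν y)] with z hzs hz
      gcongr
      have e1 := hmax (y + z) (Or.inr ⟨z, hzs, rfl⟩)
      have hzρ : ρ ≤ ‖z‖ := by simpa using hz.2
      have e2 : dist (y + z) x ^ γ ≤ ρ ^ γ + ‖z‖ ^ γ := by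
        refine le_trans (Real.rpow_le_rpow dist_nonneg ?_ hγ.le)
          (Real.rpow_add_le_add_rpow hρ.le (norm_nonneg z) hγ.le (by linarith))
        rw [dist_eq_norm, ← hρn, show y + z - x = (y - x) + z by abel]; exact norm_add_le _ _
      have e3 := rpow_le_rpow_sub_mul_rpow hρ hγα hzρ
      calc u (y + z) - u y ≤ L * dist (y + z) x ^ γ - L * ρ ^ γ := by linarith
        _ ≤ L * (ρ ^ γ + ‖z‖ ^ γ) - L * ρ ^ γ := by gcongr
        _ = L * ‖z‖ ^ γ := by ring
        _ ≤ L * (ρ ^ (γ - α) * ‖z‖ ^ α) := by gcongr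
        _ = _ := by ring
    · refine le_trans ?_ (lintegral_compl_ball_const_le h₁ hσ hR hr hyR hω)
      refine setLIntegral_mono_ae' Metric.isOpen_ball.measurableSet.compl ?_
      filter_upwards [Measure.support_mem_ae (μ := ν y)] with z hzs _
      gcongr
      exact hosc z hzs
  linarith

/-! ### Comparison with the cone -/

/-- A one-sided Hölder estimate at `x`, provided that `L` is so large that the gradient term wins
against the right-hand side and the nonlocal term at all distances `ρ < r` from `x`. -/
theorem IsBddViscSubsol.sub_le_mul_rpow {N : ℕ} {Ω : Set (E N)} {ν : E N → Measure (E N)}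
    {m θ b₀ A : ℝ} {u : E N → ℝ} (hu : IsBddViscSubsol Ω ν m θ b₀ A u)
    {σ : ℝ} {C₁ C₂ : ℝ → ℝ → ℝ} (h₁ : CondM1 σ C₁ ν) (h₂ : CondM2 σ C₂ ν) (hσ : 0 < σ)
    {R α γ r L δ : ℝ} (hR : 0 < R) (hΩR : ∀ y ∈ Ω, ‖y‖ ≤ R) (hα : σ < α) (hα1 : α ≤ 1)
    (hγ : 0 < γ) (hγα : γ ≤ α) (hγα' : γ - α = (γ - 1) * m) (hr0 : 0 < r) (hr1 : r < 1)
    (hrδ : r ≤ δ / 2) (hL : 0 < L) (hθ : 0 ≤ θ) (hA : 0 ≤ A)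
    (hLω : osc (reachSet Ω ν) u ≤ L * r ^ γ)
    (hbig : A * ((δ / 2) ^ (-θ) + 1) * r ^ (α - γ)
      + L * (5 / 2 * max (C₂ R α) 0 + max (C₁ R 0) 0) * r ^ (α - σ) < b₀ * (γ * L) ^ m)
    {x : E N} (hx : x ∈ innerSet Ω δ) {w : E N} (hw : w ∈ reachSet Ω ν) :
    u w - u x ≤ L * dist w x ^ γ := by
  obtain ⟨M, hM⟩ := hu.bounded
  obtain ⟨hxΩ, hxδ⟩ := hx
  have hδ : 0 < δ := by linarith
  have hball : Metric.closedBall x r ⊆ Ω :=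
    closedBall_subset_of_lt_bdryDist hxΩ hr0.le (by linarith)
  have hΩν : Ω ⊆ reachSet Ω ν := Set.subset_union_left
  have hcont : Continuous fun w : E N => -(L * dist w x ^ γ) :=
    (continuous_const.mul ((continuous_id.dist continuous_const).rpow_const
      fun _ => Or.inr hγ.le)).neg
  have husc : UpperSemicontinuousOn (fun w => u w + -(L * dist w x ^ γ))
      (Metric.closedBall x r) :=
    (hu.usc.mono hball).add (hcont.upperSemicontinuous.upperSemicontinuousOn _)
  obtain ⟨y, hyr, hymax⟩ := husc.exists_isMaxOn ⟨x, Metric.mem_closedBall_self hr0.le⟩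
    (isCompact_closedBall x r)
  -- At distance at least `r` the cone exceeds the oscillation. Hence the maximum over the ball is
  -- interior and global on the reachable set.
  have hout : ∀ w ∈ reachSet Ω ν, r ≤ dist w x → u w - u x ≤ L * dist w x ^ γ := by
    intro w hw hwr
    refine (sub_le_osc hM hw (hΩν hxΩ)).trans (hLω.trans ?_)
    gcongr
  by_contra! hcon
  have hwr : w ∈ Metric.closedBall x r := by
    by_contra h
    rw [Metric.mem_closedBall, not_le] at h
    exact absurd (hout w hw h.le) (not_le.2 hcon)
  have hpos : u x < u y + -(L * dist y x ^ γ) := by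
    have := hymax hwr
    simp only [Set.mem_ofPred_eq] at this
    linarith
  have hyΩ := hball hyr
  have hxy : x ≠ y := by
    rintro rfl
    simp [Real.zero_rpow hγ.ne'] at hpos
  have hyr' : dist y x < r := by
    by_contra! h
    have := hout y (hΩν hyΩ) h
    linarith
  have hglob : ∀ w ∈ reachSet Ω ν, u w - L * dist w x ^ γ ≤ u y - L * dist y x ^ γ := by
    intro w hw
    by_cases h : w ∈ Metric.closedBall x r
    · have := hymax h
      simp only [Set.mem_ofPred_eq] at this
      linarith
    · rw [Metric.mem_closedBall, not_le] at h
      have := hout w hw h.le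
      linarith
  have hreach : ∀ z ∈ (ν y).support, y + z ∈ reachSet Ω ν := fun z hz =>
    Or.inr (Set.mem_biUnion (subset_closure hyΩ) ⟨z, hz, rfl⟩)
  have hω : 0 ≤ osc (reachSet Ω ν) u := by
    simpa using sub_le_osc hM (hΩν hxΩ) (hΩν hxΩ)
  have hdy : δ - dist y x < bdryDist Ω y := by
    have := Metric.infDist_le_infDist_add_dist (s := frontier Ω) (x := x) (y := y)
    rw [dist_comm] at this
    unfold bdryDist at hxδ ⊢
    linarith
  have key := hu.gradient_estimate h₁ h₂ hσ hR hα hα1 hγ hγα hr1 hL.le hω hyΩ (hΩR y hyΩ) hxy hyr'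
    (fun z hz => sub_le_osc hM (hreach z hz) (hΩν hyΩ)) (by
      rintro w (hw | ⟨z, hz, rfl⟩)
      · exact hglob w (hΩν (closedBall_subset_of_lt_bdryDist hyΩ dist_nonneg (by linarith)
          (Metric.ball_subset_closedBall hw)))
      · exact hglob _ (hreach z hz))
  set ρ := dist y x with hρdef
  have hρ : 0 < ρ := dist_pos.2 hxy.symm
  have hd : bdryDist Ω y ^ (-θ) ≤ (δ / 2) ^ (-θ) :=
    Real.rpow_le_rpow_of_nonpos (by linarith) (by linarith) (by linarith)
  have hργ : r ^ (γ - α) ≤ ρ ^ (γ - α) :=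
    Real.rpow_le_rpow_of_nonpos hρ hyr'.le (by linarith)
  have hgrad : (γ * L * ρ ^ (γ - 1)) ^ m = (γ * L) ^ m * ρ ^ (γ - α) := by
    rw [Real.mul_rpow (by positivity) (by positivity), ← Real.rpow_mul hρ.le, ← hγα']
  -- This factor gives the source term, which carries no power of `ρ`, the common weight `ρ ^ (γ -
  -- α)`.
  have hone : 1 ≤ r ^ (α - γ) * ρ ^ (γ - α) := by
    calc (1 : ℝ) = r ^ (α - γ) * r ^ (γ - α) := by
          rw [← Real.rpow_add hr0]; simp
      _ ≤ _ := by gcongr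
  have hfar : osc (reachSet Ω ν) u * (max (C₁ R 0) 0 * r ^ (-σ))
      ≤ L * ρ ^ (γ - α) * max (C₁ R 0) 0 * r ^ (α - σ) := by
    calc osc (reachSet Ω ν) u * (max (C₁ R 0) 0 * r ^ (-σ))
        ≤ L * r ^ γ * (max (C₁ R 0) 0 * r ^ (-σ)) := by gcongr
      _ = L * r ^ (γ - α) * max (C₁ R 0) 0 * r ^ (α - σ) := by
        have : r ^ γ * r ^ (-σ) = r ^ (γ - α) * r ^ (α - σ) := by
          rw [← Real.rpow_add hr0, ← Real.rpow_add hr0]; ring_nf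
        linear_combination L * max (C₁ R 0) 0 * this
      _ ≤ _ := by gcongr
  have hrhs : A * (bdryDist Ω y ^ (-θ) + 1)
      ≤ A * ((δ / 2) ^ (-θ) + 1) * r ^ (α - γ) * ρ ^ (γ - α) := by
    calc A * (bdryDist Ω y ^ (-θ) + 1) ≤ A * ((δ / 2) ^ (-θ) + 1) * 1 := by
          rw [mul_one]; gcongr
      _ ≤ A * ((δ / 2) ^ (-θ) + 1) * (r ^ (α - γ) * ρ ^ (γ - α)) := by gcongr
      _ = _ := by ring
  rw [hgrad] at key
  have := mul_lt_mul_of_pos_right hbig (show 0 < ρ ^ (γ - α) by positivity)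
  nlinarith

/-! ### Choice of constants -/

/-- The choice of the Hölder constant `L` and of the localization radius `κ * δ` in terms of a
bound `Q` for `osc u * δ ^ (-γ)`. -/
theorem exists_holder_constants {σ m θ b₀ A γ D Q C : ℝ} (hσ : 0 < σ) (hm : σ < m) (hm1 : m ≤ 1)
    (hθ : 0 ≤ θ) (hb₀ : 0 < b₀) (hA : 0 < A) (hγ : 0 < γ) (hγ1 : γ < 1)
    (hγθ : θ ≤ (1 - γ) * m) (hD : 1 ≤ D) (hQ : 0 ≤ Q) (hC : 0 ≤ C) :
    ∃ L κ : ℝ, 0 < L ∧ 0 < κ ∧ κ * D ≤ 1 / 2 ∧ ∀ δ : ℝ, 0 < δ → δ ≤ D →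
      Q * δ ^ γ ≤ L * (κ * δ) ^ γ ∧
      A * ((δ / 2) ^ (-θ) + 1) * (κ * δ) ^ ((1 - γ) * m)
        + L * C * (κ * δ) ^ (m + γ * (1 - m) - σ) < b₀ * (γ * L) ^ m := by
  have hm0 : 0 < m := hσ.trans hm
  -- `L₁` lets half of the gradient term absorb the source; `κ` below leaves the other half for the
  -- nonlocal term.
  obtain ⟨L₁, hL₁, hL₁0⟩ := (((tendsto_rpow_atTop hm0).const_mul_atTop
    (show 0 < b₀ * γ ^ m / 2 by positivity)).eventually_gt_atTop (3 * A * D) |>.and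
    (Filter.eventually_gt_atTop 0)).exists
  have hlim : Filter.Tendsto (fun κ : ℝ => C * D * (Q + L₁) ^ (1 - m) * κ ^ (m - σ))
      (nhdsWithin 0 (Set.Ioi 0)) (nhds 0) := by
    have h : Filter.Tendsto (fun κ : ℝ => κ ^ (m - σ)) (nhds 0) (nhds 0) := by
      simpa [Real.zero_rpow (show m - σ ≠ 0 by linarith)] using
        (Real.continuousAt_rpow_const 0 (m - σ) (Or.inr (by linarith))).tendsto
    simpa using (h.mono_left nhdsWithin_le_nhds).const_mul (C * D * (Q + L₁) ^ (1 - m))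
  obtain ⟨κ, hκ, hκD, hκ0⟩ := ((hlim.eventually_lt_const
    (show 0 < b₀ * γ ^ m / 2 by positivity)).and ((Filter.Eventually.filter_mono
      nhdsWithin_le_nhds (eventually_lt_nhds (show (0 : ℝ) < 1 / (2 * D) by positivity))).and
      (eventually_mem_nhdsWithin (s := Set.Ioi (0 : ℝ)) (a := 0)))).exists
  rw [Set.mem_Ioi] at hκ0
  have hκD' : κ * D ≤ 1 / 2 := by
    rw [lt_div_iff₀ (by positivity)] at hκD; linarith
  have hκ1 : κ ≤ 1 := by nlinarith
  have hQL : 0 < Q + L₁ := by linarith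
  -- This makes `L (κ δ)^γ = (Q + L₁) δ^γ`, which dominates `Q δ^γ` for every `κ`.
  set L := (Q + L₁) * κ ^ (-γ) with hLdef
  have hL : 0 < L := by positivity
  have hLL : L₁ ≤ L := by
    have : 1 ≤ κ ^ (-γ) := Real.one_le_rpow_of_pos_of_le_one_of_nonpos hκ0 hκ1 (by linarith)
    nlinarith
  refine ⟨L, κ, hL, hκ0, hκD', fun δ hδ hδD => ⟨?_, ?_⟩⟩
  · calc Q * δ ^ γ ≤ (Q + L₁) * δ ^ γ := by gcongr; linarith
      _ = (Q + L₁) * (κ ^ (-γ) * κ ^ γ) * δ ^ γ := by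
        rw [← Real.rpow_add hκ0]; simp
      _ = L * (κ * δ) ^ γ := by
        rw [Real.mul_rpow hκ0.le hδ.le]; ring
  · have hpowD : ∀ e : ℝ, 0 ≤ e → e ≤ 1 → δ ^ e ≤ D := fun e he he1 =>
      (Real.rpow_le_rpow hδ.le hδD he).trans
        ((Real.rpow_le_rpow_of_exponent_le hD he1).trans_eq (Real.rpow_one D))
    have hβ0 : 0 ≤ (1 - γ) * m := mul_nonneg (by linarith) hm0.le
    have hβ1 : (1 - γ) * m ≤ 1 := by nlinarith
    have hfirst : A * ((δ / 2) ^ (-θ) + 1) * (κ * δ) ^ ((1 - γ) * m) ≤ 3 * A * D := by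
      have e1 : (κ * δ) ^ ((1 - γ) * m) ≤ δ ^ ((1 - γ) * m) := by
        gcongr; nlinarith
      have e2 : (δ / 2) ^ (-θ) * δ ^ ((1 - γ) * m) ≤ 2 * D := by
        calc (δ / 2) ^ (-θ) * δ ^ ((1 - γ) * m)
            = 2 ^ θ * δ ^ ((1 - γ) * m - θ) := by
              rw [Real.div_rpow hδ.le (by norm_num), Real.rpow_neg (by norm_num : (0 : ℝ) ≤ 2),
                div_inv_eq_mul, sub_eq_add_neg _ θ, Real.rpow_add hδ]
              ring
          _ ≤ 2 ^ (1 : ℝ) * D := by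
              gcongr
              · norm_num
              · linarith
              · exact hpowD _ (by linarith) (by linarith)
          _ = 2 * D := by rw [Real.rpow_one]
      have e3 := hpowD _ hβ0 hβ1
      calc A * ((δ / 2) ^ (-θ) + 1) * (κ * δ) ^ ((1 - γ) * m)
          ≤ A * ((δ / 2) ^ (-θ) + 1) * δ ^ ((1 - γ) * m) := by gcongr
        _ = A * ((δ / 2) ^ (-θ) * δ ^ ((1 - γ) * m) + δ ^ ((1 - γ) * m)) := by ring
        _ ≤ A * (2 * D + D) := by gcongr
        _ = _ := by ring
    have hγL : (γ * L) ^ m = γ ^ m * L ^ m := Real.mul_rpow hγ.le hL.le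
    have hL₁L : L₁ ^ m ≤ L ^ m := by gcongr
    have hA' : 3 * A * D < b₀ * γ ^ m / 2 * L ^ m :=
      hL₁.trans_le (by gcongr)
    have hexp : 0 ≤ m + γ * (1 - m) - σ := by nlinarith
    have hexp1 : m + γ * (1 - m) - σ ≤ 1 := by nlinarith
    have hsecond : L * C * (κ * δ) ^ (m + γ * (1 - m) - σ) ≤ b₀ * γ ^ m / 2 * L ^ m := by
      have e1 : L = L ^ m * L ^ (1 - m) := by rw [← Real.rpow_add hL]; simp
      -- The growth `κ^(-γ(1-m))` of `L^(1-m)` is cancelled exactly, leaving the positive exponent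
      -- `m - σ`.
      have e2 : L ^ (1 - m) * κ ^ (m + γ * (1 - m) - σ) = (Q + L₁) ^ (1 - m) * κ ^ (m - σ) := by
        rw [hLdef, Real.mul_rpow hQL.le (by positivity), ← Real.rpow_mul hκ0.le, mul_assoc,
          ← Real.rpow_add hκ0]
        ring_nf
      calc L * C * (κ * δ) ^ (m + γ * (1 - m) - σ)
          = L * C * (κ ^ (m + γ * (1 - m) - σ) * δ ^ (m + γ * (1 - m) - σ)) := by
            rw [Real.mul_rpow hκ0.le hδ.le]
        _ ≤ L * C * (κ ^ (m + γ * (1 - m) - σ) * D) := by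
            gcongr; exact hpowD _ hexp hexp1
        _ = L ^ m * (C * D * (L ^ (1 - m) * κ ^ (m + γ * (1 - m) - σ))) := by
            nth_rewrite 1 [e1]; ring
        _ = L ^ m * (C * D * (Q + L₁) ^ (1 - m) * κ ^ (m - σ)) := by rw [e2]; ring
        _ ≤ L ^ m * (b₀ * γ ^ m / 2) := by gcongr
        _ = _ := by ring
    rw [hγL]
    linarith

/-! ### Estimates on `Ω^δ` and on compact sets -/

/-- The Hölder estimate on `Ω^δ` with a constant depending on an upper bound `Q` of
`osc u * δ ^ (-γ)` and on the data only. -/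
theorem exists_holder_constant_of_osc_le {N : ℕ} {Ω : Set (E N)} (hΩb : Bornology.IsBounded Ω)
    {σ m θ b₀ A γ : ℝ} (C₁ C₂ : ℝ → ℝ → ℝ) (hσ : 0 < σ) (hm : σ < m) (hm1 : m ≤ 1)
    (hθ : 0 ≤ θ) (hb₀ : 0 < b₀) (hA : 0 < A) (hγ : 0 < γ) (hγ1 : γ < 1)
    (hγθ : θ ≤ (1 - γ) * m) {Q : ℝ} (hQ : 0 ≤ Q) :
    ∃ L : ℝ, 0 ≤ L ∧ ∀ ν : E N → Measure (E N), CondM1 σ C₁ ν → CondM2 σ C₂ ν →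
      ∀ u : E N → ℝ, IsBddViscSubsol Ω ν m θ b₀ A u → ∀ δ : ℝ, 0 < δ →
        osc (reachSet Ω ν) u * δ ^ (-γ) ≤ Q →
        ∀ x ∈ innerSet Ω δ, ∀ y ∈ innerSet Ω δ, |u x - u y| ≤ L * dist x y ^ γ := by
  obtain ⟨R, hR, hΩR⟩ := hΩb.exists_pos_norm_le
  obtain ⟨L, κ, hL, hκ, hκD, h⟩ := exists_holder_constants (D := 2 * R + 1)
    (C := 5 / 2 * max (C₂ R (m + γ * (1 - m))) 0 + max (C₁ R 0) 0)
    hσ hm hm1 hθ hb₀ hA hγ hγ1 hγθ (by linarith) hQ (by positivity)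
  refine ⟨L, hL.le, fun ν h₁ h₂ u hu δ hδ hδQ => ?_⟩
  have hone : ∀ x ∈ innerSet Ω δ, ∀ y ∈ innerSet Ω δ, u y - u x ≤ L * dist y x ^ γ := by
    intro x hx y hy
    have hδD : δ ≤ 2 * R + 1 := by
      -- The distance to an empty set is `0` by convention, so a point of `Ω^δ` forces a nonempty
      -- frontier.
      have hne : (frontier Ω).Nonempty := by
        by_contra hem
        have := hx.2
        rw [bdryDist, Set.not_nonempty_iff_eq_empty.1 hem, Metric.infDist_empty] at this
        linarith
      obtain ⟨z, hz⟩ := hne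
      have hzR : ‖z‖ ≤ R := by
        have : closure Ω ⊆ Metric.closedBall 0 R :=
          closure_minimal (fun w hw => by simpa using hΩR w hw) Metric.isClosed_closedBall
        simpa using this hz.1
      have e1 := Metric.infDist_le_dist_of_mem (x := x) hz
      have e2 := dist_le_norm_add_norm x z
      have e3 := hΩR x hx.1
      have e4 := hx.2
      unfold bdryDist at e4
      linarith
    obtain ⟨hosc, hbig⟩ := h δ hδ hδD
    have hexp : m + γ * (1 - m) - γ = (1 - γ) * m := by ring
    refine hu.sub_le_mul_rpow h₁ h₂ hσ (R := R) (α := m + γ * (1 - m)) (r := κ * δ) (δ := δ)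
      hR hΩR ?_ ?_ hγ ?_ (by ring) (by positivity) ?_ ?_ hL hθ hA.le ?_ ?_ hx (Or.inl hy.1)
    · nlinarith
    · nlinarith
    · nlinarith
    · nlinarith
    · nlinarith
    · refine le_trans ?_ hosc
      rwa [Real.rpow_neg hδ.le, ← div_eq_mul_inv, div_le_iff₀ (by positivity)] at hδQ
    · rwa [hexp]
  intro x hx y hy
  rw [abs_le]
  have e1 := hone x hx y hy
  have e2 := hone y hy x hx
  rw [dist_comm] at e1
  constructor <;> linarith

/-- A compact subset of an open set with nonempty frontier lies in some `Ω^δ`. -/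
theorem exists_subset_innerSet {N : ℕ} {Ω S : Set (E N)} (hΩ : IsOpen Ω)
    (hf : (frontier Ω).Nonempty) (hS : IsCompact S) (hSΩ : S ⊆ Ω) :
    ∃ δ : ℝ, 0 < δ ∧ S ⊆ innerSet Ω δ := by
  rcases S.eq_empty_or_nonempty with rfl | hne
  · exact ⟨1, one_pos, Set.empty_subset _⟩
  obtain ⟨x, hx, hmin⟩ := hS.exists_isMinOn hne
    (Metric.continuous_infDist_pt (frontier Ω)).continuousOn
  have hpos : 0 < Metric.infDist x (frontier Ω) := by
    rw [← isClosed_frontier.notMem_iff_infDist_pos hf]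
    intro hxf
    have : x ∈ Ω ∩ frontier Ω := ⟨hSΩ hx, hxf⟩
    rw [hΩ.inter_frontier_eq] at this
    exact this
  refine ⟨Metric.infDist x (frontier Ω) / 2, by linarith, fun y hy => ⟨hSΩ hy, ?_⟩⟩
  have : Metric.infDist x (frontier Ω) ≤ Metric.infDist y (frontier Ω) := hmin hy
  unfold bdryDist
  linarith

end NonlocalHJ

theorem mainTheorem12 (N : ℕ) (Ω : Set (NonlocalHJ.E N))
    (hΩo : IsOpen Ω) (hΩc : IsConnected Ω) (hΩb : Bornology.IsBounded Ω)
    (σ : ℝ) (hσ : σ ∈ Set.Ioo (0 : ℝ) 1)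
    (m : ℝ) (hm : m ∈ Set.Ioc σ 1)
    (θ : ℝ) (hθ : θ ∈ Set.Ico 0 m)
    (C₁ C₂ : ℝ → ℝ → ℝ)
    (b₀ : ℝ) (hb₀ : 0 < b₀) (A : ℝ) (hA : 0 < A)
    (γ : ℝ) (hγ : 0 < γ) (hγ₀ : γ < min 1 ((m - θ) / m)) :
    ∃ K : ℝ → ℝ, Monotone K ∧
      ∀ ν : NonlocalHJ.E N → MeasureTheory.Measure (NonlocalHJ.E N),
        NonlocalHJ.CondM1 σ C₁ ν → NonlocalHJ.CondM2 σ C₂ ν →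
        ∀ u : NonlocalHJ.E N → ℝ, NonlocalHJ.IsBddViscSubsol Ω ν m θ b₀ A u →
          (∀ S : Set (NonlocalHJ.E N), IsCompact S → S ⊆ Ω →
            ∃ L : ℝ, ∀ x ∈ S, ∀ y ∈ S, |u x - u y| ≤ L * dist x y ^ γ) ∧
          (∀ δ : ℝ, 0 < δ →
            ∀ x ∈ NonlocalHJ.innerSet Ω δ, ∀ y ∈ NonlocalHJ.innerSet Ω δ,
              |u x - u y| ≤
                K (NonlocalHJ.osc (NonlocalHJ.reachSet Ω ν) u * δ ^ (-γ)) * dist x y ^ γ) := by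
  have hm0 : 0 < m := hσ.1.trans hm.1
  have hγ1 : γ < 1 := hγ₀.trans_le (min_le_left _ _)
  have hγθ : θ ≤ (1 - γ) * m := by
    have := hγ₀.trans_le (min_le_right _ _)
    rw [lt_div_iff₀ hm0] at this
    linarith
  -- Constants are chosen at integer thresholds; summing them up to index `⌈q⌉₊` makes `K` monotone.
  choose L hL0 hL using fun n : ℕ => NonlocalHJ.exists_holder_constant_of_osc_le hΩb C₁ C₂
    hσ.1 hm.1 hm.2 hθ.1 hb₀ hA hγ hγ1 hγθ (Nat.cast_nonneg (α := ℝ) n)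
  refine ⟨fun q => ∑ i ∈ Finset.range (⌈q⌉₊ + 1), L i, fun q q' hq => ?_, ?_⟩
  · refine Finset.sum_le_sum_of_subset_of_nonneg ?_ fun i _ _ => hL0 i
    have := Nat.ceil_mono hq
    exact Finset.range_subset_range.2 (by omega)
  intro ν h₁ h₂ u hu
  refine and_iff_right_of_imp (fun hH S hS hSΩ => ?_) |>.2 fun δ hδ x hx y hy => ?_
  · rcases (frontier Ω).eq_empty_or_nonempty with hf | hf
    -- With empty frontier every `Ω^δ` is empty and the estimate says nothing; but then the whole
    -- space is bounded, hence a point.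
    · have huniv : Ω = Set.univ :=
        (frontier_eq_empty_iff.1 hf).resolve_left hΩc.nonempty.ne_empty
      have hsub : Subsingleton (NonlocalHJ.E N) := by
        by_contra hns
        rw [not_subsingleton_iff_nontrivial] at hns
        exact NormedSpace.unbounded_univ ℝ (NonlocalHJ.E N) (huniv ▸ hΩb)
      refine ⟨0, fun x _ y _ => ?_⟩
      simp [Subsingleton.elim x y]
    · obtain ⟨δ, hδ, hSδ⟩ := NonlocalHJ.exists_subset_innerSet hΩo hf hS hSΩ
      exact ⟨_, fun x hx y hy => hH δ hδ x (hSδ hx) y (hSδ hy)⟩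
  · refine (hL _ ν h₁ h₂ u hu δ hδ (Nat.le_ceil _) x hx y hy).trans ?_
    gcongr
    exact Finset.single_le_sum (f := L) (fun i _ => hL0 i) (Finset.self_mem_range_succ _)
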